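/- Let $n \ge 2$. Any $n$-process obstruction-free binary consensus algorithm from readable binary swap objects uses at least $n-2$ objects. Here a readable binary swap object stores a value in $\{0,1\}$ and supports the atomic operations Read, which returns the current value, and Swap$(w)$ for $w\in\{0,1\}$, which sets the value to $w$ and returns the previous value. A (deterministic) algorithm consists of a set of such objects with fixed initial values and a deterministic procedure for each of $n$ asynchronous processes. Each process starts in a state determined by its input in $\{0,1\}$; in each state it either has decided a value in $\{0,1\}$, and then takes no further steps, or is poised to apply an operation to one of the objects; in a step it applies that operation, and its next state is determined by its current state and the response. A configuration consists of a state for every process and a value for every object, and an execution is a sequence of steps in which a scheduler chooses, at each point, an undecided process to take the next step. The algorithm is a binary consensus algorithm if, in every execution from an initial configuration, at most one value is decided (agreement) and every decided value is the input of some process (validity). It is obstruction-free if, for every configuration $C$ reachable from an initial configuration and every process $p$, there is a finite execution from $C$ in which only $p$ takes steps and at the end of which $p$ has decided. The number of objects used by the algorithm is the cardinality of its set of objects (possibly infinite). -/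

import Mathlib

/-- The operations on a collection `Obj` of readable binary swap objects: `Read` of the object `B`,
and `Swap(w)` on the object `B` with `w ∈ {0, 1}`. -/
inductive SwapOp (Obj : Type*) where
  | read (B : Obj)
  | swap (B : Obj) (w : Fin 2)

namespace SwapOp

/-- The object to which an operation is applied. -/
def target {Obj : Type*} : SwapOp Obj → Obj
  | read B => B
  | swap B _ => B

/-- The value of the accessed object after the operation, if its value before was `v`.
(The response to either operation is the previous value `v`.) -/
def newValue {Obj : Type*} : SwapOp Obj → Fin 2 → Fin 2
  | read _, v => v
  | swap _ w, _ => w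

end SwapOp

/-- A deterministic asynchronous shared-memory algorithm for `n` processes with binary inputs and
outputs, whose shared objects are the readable binary swap objects `Obj`. Processes may run
different procedures; `State` is the type of local states. -/
structure SwapAlgorithm (n : ℕ) (Obj State : Type*) where
  /-- Initial values of the shared objects. -/
  initValue : Obj → Fin 2
  /-- Initial state of each process, given its input. -/
  initState : Fin n → Fin 2 → State
  /-- In each of its states, a process either has decided a value (`Sum.inl v`) or is poised to
  apply an operation to some object (`Sum.inr op`). -/
  status : Fin n → State → Fin 2 ⊕ SwapOp Obj
  /-- `update p s r` is the state of process `p` after it applies, in state `s`, the operation it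
  is poised to apply and obtains the response `r`. -/
  update : Fin n → State → Fin 2 → State

/-- A configuration: a state for every process and a value for every object. -/
@[ext]
structure SwapConfig (n : ℕ) (Obj State : Type*) where
  state : Fin n → State
  value : Obj → Fin 2

namespace SwapAlgorithm

variable {n : ℕ} {Obj State : Type*}

/-- The initial configuration in which process `p` has input `x p`. -/
def initConfig (A : SwapAlgorithm n Obj State) (x : Fin n → Fin 2) : SwapConfig n Obj State where
  state p := A.initState p (x p)
  value := A.initValue

/-- Process `p` has decided the value `v` in the configuration `C`. -/
def HasDecided (A : SwapAlgorithm n Obj State) (C : SwapConfig n Obj State) (p : Fin n)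
    (v : Fin 2) : Prop :=
  A.status p (C.state p) = Sum.inl v

/-- Process `p` is poised to apply the operation `op` in the configuration `C`. -/
def Poised (A : SwapAlgorithm n Obj State) (C : SwapConfig n Obj State) (p : Fin n)
    (op : SwapOp Obj) : Prop :=
  A.status p (C.state p) = Sum.inr op

open Classical in
/-- The configuration that results from `C` when process `p` applies the operation `op`, obtains
the old value of the accessed object as the response, and updates its state. -/
noncomputable def applyOp (A : SwapAlgorithm n Obj State) (C : SwapConfig n Obj State) (p : Fin n)
    (op : SwapOp Obj) : SwapConfig n Obj State where
  state := Function.update C.state p (A.update p (C.state p) (C.value op.target))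
  value := Function.update C.value op.target (op.newValue (C.value op.target))

/-- `A.Step p C C'`: process `p`, which has not decided in `C`, takes its next step in `C`, and
`C'` is the resulting configuration. -/
def Step (A : SwapAlgorithm n Obj State) (p : Fin n) (C C' : SwapConfig n Obj State) : Prop :=
  ∃ op, A.Poised C p op ∧ C' = A.applyOp C p op

/-- `A.Execution P C C'`: there is a finite `P`-only execution from `C` that ends with `C'`. -/
def Execution (A : SwapAlgorithm n Obj State) (P : Set (Fin n)) :
    SwapConfig n Obj State → SwapConfig n Obj State → Prop :=
  Relation.ReflTransGen fun C C' => ∃ p ∈ P, A.Step p C C'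

/-- `C` is reached by a finite execution from the initial configuration with inputs `x`. -/
def ReachableFrom (A : SwapAlgorithm n Obj State) (x : Fin n → Fin 2)
    (C : SwapConfig n Obj State) : Prop :=
  A.Execution Set.univ (A.initConfig x) C

/-- Agreement: in every execution from an initial configuration, no two different values are
decided. (A process that has decided takes no further steps, so its decision persists.) -/
def Agreement (A : SwapAlgorithm n Obj State) : Prop :=
  ∀ x C, A.ReachableFrom x C →
    ∀ p q v w, A.HasDecided C p v → A.HasDecided C q w → v = w

/-- Validity: every decided value is the input of some process. -/
def Validity (A : SwapAlgorithm n Obj State) : Prop :=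
  ∀ x C, A.ReachableFrom x C → ∀ p v, A.HasDecided C p v → ∃ q, x q = v

/-- `A` is a binary consensus algorithm. -/
def IsBinaryConsensus (A : SwapAlgorithm n Obj State) : Prop :=
  A.Agreement ∧ A.Validity

/-- Solo termination, which for these (deterministic) algorithms is obstruction-freedom: from every
reachable configuration `C`, every process `p` has a finite `p`-only execution ending with a
configuration in which `p` has decided. -/
def ObstructionFree (A : SwapAlgorithm n Obj State) : Prop :=
  ∀ x C, A.ReachableFrom x C → ∀ p, ∃ C', A.Execution {p} C C' ∧ ∃ v, A.HasDecided C' p v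

end SwapAlgorithm

/-! ### Indistinguishability and bivalence. -/

namespace SwapAlgorithm

variable {n : ℕ} {Obj State : Type*}

/-! The first two processes are kept bivalent while the others are parked one at a time, from the
highest index down, at pairwise distinct objects; these are the n - 2 objects. A process `p` is
parked just before a response `ρ p` that it cannot obtain from the processes of index at most `p`
while the first two stay bivalent.

As values are binary, this fixes what occupied objects can do: by `Parked.exists_forall_value_ne`
the first two can move so that each holds the value other than `ρ p`, and by `Parked.newValue_ne` no
active process is poised to swap `ρ p` in. Both rest on `Bivalent.exists_overwrite`. In
`Parked.exists_succ` the next process runs alone up to the first response that cannot be reproduced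
under bivalence. On occupied objects every response of that run can be, so it stops at a new object.
-/

/-- Two configurations that no process of `P` can tell apart. -/
def Agree (P : Set (Fin n)) (C D : SwapConfig n Obj State) : Prop :=
  C.value = D.value ∧ ∀ p ∈ P, C.state p = D.state p

/-- Some `P`-only execution from `C` ends with a process of `P` having decided `v`. -/
def CanDecide (A : SwapAlgorithm n Obj State) (P : Set (Fin n)) (C : SwapConfig n Obj State)
    (v : Fin 2) : Prop :=
  ∃ C', A.Execution P C C' ∧ ∃ p ∈ P, A.HasDecided C' p v

/-- From `C`, the processes of `P` can decide either value. -/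
def Bivalent (A : SwapAlgorithm n Obj State) (P : Set (Fin n)) (C : SwapConfig n Obj State) :
    Prop :=
  ∀ v, A.CanDecide P C v

/-- The configuration `C` with the values of the objects in the domain of `g` replaced. -/
def overwrite (C : SwapConfig n Obj State) (g : Obj → Option (Fin 2)) :
    SwapConfig n Obj State where
  state := C.state
  value B := (g B).getD (C.value B)

/-- The processes with index less than `m`. -/
def below (n m : ℕ) : Set (Fin n) := {p | p.val < m}

variable {A : SwapAlgorithm n Obj State} {P P' : Set (Fin n)} {C C' D : SwapConfig n Obj State}

theorem below_mono {m m' : ℕ} (h : m ≤ m') : below n m ⊆ below n m' :=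
  fun _ hp => lt_of_lt_of_le hp h

theorem Execution.mono (h : P ⊆ P') (hC : A.Execution P C C') : A.Execution P' C C' :=
  Relation.ReflTransGen.mono (fun _ _ ⟨p, hp, hs⟩ => ⟨p, h hp, hs⟩) _ _ hC

theorem Execution.trans (h : A.Execution P C C') (h' : A.Execution P C' D) :
    A.Execution P C D :=
  Relation.ReflTransGen.trans h h'

theorem Poised.execution {p : Fin n} {op : SwapOp Obj} (h : A.Poised C p op) (hp : p ∈ P) :
    A.Execution P C (A.applyOp C p op) :=
  Relation.ReflTransGen.single ⟨p, hp, op, h, rfl⟩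

theorem Execution.state_eq (h : A.Execution P C C') {p : Fin n} (hp : p ∉ P) :
    C'.state p = C.state p := by
  induction h with
  | refl => rfl
  | tail _ hs ih =>
    obtain ⟨q, hq, op, _, rfl⟩ := hs
    have : p ≠ q := fun e => hp (e ▸ hq)
    simp [applyOp, this, ih]

theorem ReachableFrom.execution {x : Fin n → Fin 2} (h : A.ReachableFrom x C)
    (h' : A.Execution P C C') : A.ReachableFrom x C' :=
  Execution.trans h (h'.mono (Set.subset_univ P))

theorem Agree.execution (h : Agree P C D) (hC : A.Execution P C C') :
    ∃ D', A.Execution P D D' ∧ Agree P C' D' := by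
  induction hC with
  | refl => exact ⟨D, Relation.ReflTransGen.refl, h⟩
  | tail _ hs ih =>
    obtain ⟨E, hE, hv, hst⟩ := ih
    obtain ⟨p, hp, op, hpo, rfl⟩ := hs
    have hpo' : A.Poised E p op := by
      unfold Poised at *
      rw [← hst p hp, hpo]
    refine ⟨_, hE.trans (hpo'.execution hp), ?_, fun q hq => ?_⟩
    · simp [applyOp, hv]
    · by_cases hqp : q = p
      · subst hqp
        simp [applyOp, hv, hst q hq]
      · simp [applyOp, hqp, hst q hq]

theorem Agree.canDecide (h : Agree P C D) {v : Fin 2} (hC : A.CanDecide P C v) :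
    A.CanDecide P D v := by
  obtain ⟨C', hC', p, hp, hd⟩ := hC
  obtain ⟨D', hD', _, hst⟩ := h.execution hC'
  refine ⟨D', hD', p, hp, ?_⟩
  unfold HasDecided at *
  rw [← hst p hp, hd]

theorem Agree.bivalent (h : Agree P C D) (hC : A.Bivalent P C) : A.Bivalent P D :=
  fun v => h.canDecide (hC v)

theorem CanDecide.mono (h : P ⊆ P') {v : Fin 2} (hC : A.CanDecide P C v) :
    A.CanDecide P' C v := by
  obtain ⟨C', hC', p, hp, hd⟩ := hC
  exact ⟨C', hC'.mono h, p, h hp, hd⟩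

theorem CanDecide.of_execution {v : Fin 2} (h : A.Execution P C C') (hC : A.CanDecide P C' v) :
    A.CanDecide P C v := by
  obtain ⟨D, hD, hd⟩ := hC
  exact ⟨D, h.trans hD, hd⟩

theorem HasDecided.of_execution {p : Fin n} {v : Fin 2} (hd : A.HasDecided C p v)
    (h : A.Execution P C C') : A.HasDecided C' p v := by
  induction h with
  | refl => exact hd
  | tail _ hs ih =>
    obtain ⟨q, _, op, hpo, rfl⟩ := hs
    have : p ≠ q := by
      rintro rfl
      unfold HasDecided Poised at *
      rw [ih] at hpo
      cases hpo
    unfold HasDecided at *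
    simpa [applyOp, this] using ih

theorem ReachableFrom.exists_canDecide (hof : A.ObstructionFree) {x : Fin n → Fin 2}
    (h : A.ReachableFrom x C) (p : Fin n) : ∃ v, A.CanDecide {p} C v := by
  obtain ⟨C', hC', v, hv⟩ := hof x C h p
  exact ⟨v, C', hC', p, rfl, hv⟩

/-- Agreement: nobody has decided while some set of processes is bivalent. -/
theorem Bivalent.not_hasDecided (hag : A.Agreement) {x : Fin n → Fin 2}
    (hC : A.ReachableFrom x C) (h : A.Bivalent P C) (p : Fin n) (v : Fin 2) :
    ¬ A.HasDecided C p v := by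
  intro hd
  have key : ∀ w, v = w := by
    intro w
    obtain ⟨C', hC', q, _, hq⟩ := h w
    exact hag x C' (hC.execution hC') p q v w (hd.of_execution hC') hq
  have h0 := key 0
  have h1 := key 1
  rw [h0] at h1
  exact absurd h1 (by decide)

/-! ### Bivalence under overwriting, and block steps. -/

/-- A bivalent set `P` can move so that it is still bivalent once the objects in the domain of `g`
are overwritten: a step on such an object is then visible only to the process that took it. -/
theorem Bivalent.exists_overwrite (hP : ∀ q ∈ P, ∃ q' ∈ P, q' ≠ q) (h : A.Bivalent P C)
    (g : Obj → Option (Fin 2))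
    (hsolo : ∀ E, A.Execution P C E → ∀ q ∈ P, ∃ v, A.CanDecide {q} (overwrite E g) v) :
    ∃ E, A.Execution P C E ∧ A.Bivalent P (overwrite E g) := by
  by_contra hno
  have hno' : ∀ E, A.Execution P C E → ¬ A.Bivalent P (overwrite E g) :=
    fun E hE hb => hno ⟨E, hE, hb⟩
  obtain ⟨x, hx⟩ : ∃ x, ¬ A.CanDecide P (overwrite C g) x := by
    by_contra hall
    exact hno' C Relation.ReflTransGen.refl (fun v => by_contra fun hv => hall ⟨v, hv⟩)
  -- Once lost, the decision `x` stays lost. But some execution decides `x`, and overwriting keeps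
  -- local states.
  have key : ∀ E, A.Execution P C E → ¬ A.CanDecide P (overwrite E g) x := by
    intro E hE
    induction hE with
    | refl => exact hx
    | @tail E E' hE hs ih =>
      have hE' : A.Execution P C E' := Relation.ReflTransGen.tail hE hs
      obtain ⟨q, hq, op, hpo, rfl⟩ := hs
      intro hcan
      rcases hg : g op.target with _ | w
      · have hval : overwrite (A.applyOp E q op) g = A.applyOp (overwrite E g) q op := by
          ext r
          · simp [overwrite, applyOp, hg]
          · by_cases hr : r = op.target
            · subst hr
              simp [overwrite, applyOp, hg]
            · simp [overwrite, applyOp, hr]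
        rw [hval] at hcan
        have hpo' : A.Poised (overwrite E g) q op := hpo
        exact ih (hcan.of_execution (hpo'.execution hq))
      -- The overwritten configurations before and after differ only in the state of `q`, so `q'`
      -- alone decides the same `v ≠ x` from both.
      · obtain ⟨q', hq', hne⟩ := hP q hq
        obtain ⟨v, hv⟩ := hsolo E hE q' hq'
        have hag : Agree {q'} (overwrite E g) (overwrite (A.applyOp E q op) g) := by
          refine ⟨?_, ?_⟩
          · funext B
            by_cases hB : B = op.target
            · subst hB
              simp [overwrite, hg]
            · simp [overwrite, applyOp, hB]
          · rintro r rfl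
            simp [overwrite, applyOp, hne]
        have hsub : ({q'} : Set (Fin n)) ⊆ P := by simpa using hq'
        have hvx : v ≠ x := by
          rintro rfl
          exact ih (hv.mono hsub)
        have hv' := (hag.canDecide hv).mono hsub
        refine hno' _ hE' fun y => ?_
        have : y = v ∨ y = x := by omega
        rcases this with rfl | rfl
        · exact hv'
        · exact hcan
  obtain ⟨F, hF, q, hq, hd⟩ := h x
  exact key F hF ⟨_, Relation.ReflTransGen.refl, q, hq, hd⟩

/-- Processes poised at operations on distinct objects can take one step each. -/
theorem exists_block_execution (C : SwapConfig n Obj State) (op : Fin n → SwapOp Obj)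
    (S : Finset (Fin n)) (hpo : ∀ p ∈ S, A.Poised C p (op p))
    (hinj : ∀ p ∈ S, ∀ q ∈ S, (op p).target = (op q).target → p = q) :
    ∃ D, A.Execution S C D ∧
      (∀ p ∈ S, D.state p = A.update p (C.state p) (C.value (op p).target)) ∧
      (∀ p ∉ S, D.state p = C.state p) ∧
      (∀ p ∈ S, D.value (op p).target = (op p).newValue (C.value (op p).target)) ∧
      ∀ B, (∀ p ∈ S, (op p).target ≠ B) → D.value B = C.value B := by
  classical
  induction S using Finset.induction_on with
  | empty => exact ⟨C, Relation.ReflTransGen.refl, by simp, by simp, by simp, by simp⟩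
  | insert a S ha ih =>
    obtain ⟨D, hD, hS, hnS, hv, hB⟩ := ih (fun p hp => hpo p (Finset.mem_insert_of_mem hp))
      (fun p hp q hq => hinj p (Finset.mem_insert_of_mem hp) q (Finset.mem_insert_of_mem hq))
    have hpa : A.Poised D a (op a) := by
      have := hpo a (Finset.mem_insert_self a S)
      unfold Poised at *
      rw [hnS a ha, this]
    have hne : ∀ p ∈ S, (op p).target ≠ (op a).target := fun p hp e => ha
      (hinj p (Finset.mem_insert_of_mem hp) a (Finset.mem_insert_self a S) e ▸ hp)
    have hva : D.value (op a).target = C.value (op a).target := hB _ hne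
    refine ⟨A.applyOp D a (op a),
      (hD.mono (by simp)).trans (hpa.execution (by simp)), ?_, ?_, ?_, ?_⟩
    · intro p hp
      by_cases hpa : p = a
      · subst hpa
        simp [applyOp, hva, hnS p ha]
      · have hp' : p ∈ S := Finset.mem_of_mem_insert_of_ne hp hpa
        simp [applyOp, hpa, hS p hp']
    · intro p hp
      have hpa : p ≠ a := fun e => hp (e ▸ Finset.mem_insert_self a S)
      have hp' : p ∉ S := fun h => hp (Finset.mem_insert_of_mem h)
      simp [applyOp, hpa, hnS p hp']
    · intro p hp
      by_cases hpa : p = a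
      · subst hpa
        simp [applyOp, hva]
      · have hp' : p ∈ S := Finset.mem_of_mem_insert_of_ne hp hpa
        simp [applyOp, hne p hp', hv p hp']
    · intro B hB'
      have h1 : B ≠ (op a).target := (hB' a (Finset.mem_insert_self a S)).symm
      simp only [applyOp, ne_eq, h1, not_false_eq_true, Function.update_of_ne]
      exact hB B fun p hp => hB' p (Finset.mem_insert_of_mem hp)

/-- A step that does not change the accessed object is visible only to the process taking it. -/
theorem agree_applyOp {p : Fin n} (hp : p ∉ P) {op : SwapOp Obj}
    (h : op.newValue (C.value op.target) = C.value op.target) :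
    Agree P C (A.applyOp C p op) := by
  refine ⟨?_, fun q hq => ?_⟩
  · simp [applyOp, h]
  · have : q ≠ p := fun e => hp (e ▸ hq)
    simp [applyOp, this]

end SwapAlgorithm

theorem SwapOp.target_swap {Obj : Type*} (B : Obj) (w : Fin 2) : (swap B w).target = B := rfl

theorem SwapOp.newValue_swap {Obj : Type*} (B : Obj) (w v : Fin 2) :
    (swap B w).newValue v = w := rfl

theorem SwapOp.newValue_eq_of_ne {Obj : Type*} {op : SwapOp Obj} {v : Fin 2}
    (h : op.newValue v ≠ v) (u : Fin 2) : op.newValue u = op.newValue v := by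
  cases op with
  | read B => exact absurd rfl h
  | swap B w => rfl

/-! ### Parked processes and the values of their objects. -/

namespace SwapAlgorithm

variable {n : ℕ} {Obj State : Type*} {A : SwapAlgorithm n Obj State}
  {C D E K : SwapConfig n Obj State} {m : ℕ} {op : Fin n → SwapOp Obj} {ρ : Fin n → Fin 2}

/-- The first two processes are bivalent in `K`, and every process `p` with index at least `m` is
poised at its own object, where no execution by processes with index at most `p` lets it obtain the
response `ρ p` and leaves the first two processes bivalent. -/
structure Parked (A : SwapAlgorithm n Obj State) (m : ℕ) (K : SwapConfig n Obj State)
    (op : Fin n → SwapOp Obj) (ρ : Fin n → Fin 2) : Prop where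
  bivalent : A.Bivalent (below n 2) K
  poised : ∀ p : Fin n, m ≤ p.val → A.Poised K p (op p)
  avoid : ∀ p : Fin n, m ≤ p.val → ∀ K', A.Execution (below n (p.val + 1)) K K' →
    A.Bivalent (below n 2) K' → K'.state p ≠ A.update p (K.state p) (ρ p)
  injective : ∀ p q : Fin n, m ≤ p.val → m ≤ q.val → (op p).target = (op q).target → p = q

theorem Poised.congr {p : Fin n} {o : SwapOp Obj} (h : A.Poised C p o)
    (hst : D.state p = C.state p) : A.Poised D p o := by
  unfold Poised at *
  rw [hst, h]

theorem not_mem_below {p : Fin n} (h : m ≤ p.val) : p ∉ below n m := not_lt.mpr h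

/-- From a configuration of a `Parked` execution, a parked process cannot take its step so that the
first two processes see no change and it obtains the response `ρ p`. -/
theorem Parked.false_of_agree (h : A.Parked m K op ρ) {p : Fin n} (hp : m ≤ p.val)
    (hC : A.Bivalent (below n 2) C) (hKD : A.Execution (below n (p.val + 1)) K D)
    (hagree : Agree (below n 2) C D) (hst : D.state p = A.update p (K.state p) (ρ p)) : False :=
  h.avoid p hp D hKD (hagree.bivalent hC) hst

/-- Otherwise `p` would obtain `ρ p` by a step that changes no object. -/
theorem Parked.value_ne_of_trivial (h : A.Parked m K op ρ) (hm : 2 ≤ m) {p : Fin n}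
    (hp : m ≤ p.val) (htriv : (op p).newValue (ρ p) = ρ p)
    (hE : A.Execution (below n m) K E) (hbiv : A.Bivalent (below n 2) E) :
    E.value (op p).target ≠ ρ p := by
  intro hval
  have hst : E.state p = K.state p := hE.state_eq (not_mem_below hp)
  have hpo : A.Poised E p (op p) := (h.poised p hp).congr hst
  refine h.false_of_agree hp hbiv
    ((hE.mono (below_mono (by omega))).trans (hpo.execution (Nat.lt_succ_self p.val)))
    (agree_applyOp (not_mem_below (hm.trans hp)) (by rw [hval, htriv])) ?_
  simp [applyOp, hst, hval]

open Classical in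
/-- The values written by the parked processes whose operation would change the value `ρ p`. -/
noncomputable def parkedWrites (m : ℕ) (op : Fin n → SwapOp Obj) (ρ : Fin n → Fin 2) (B : Obj) :
    Option (Fin 2) :=
  if h : ∃ p : Fin n, m ≤ p.val ∧ (op p).newValue (ρ p) ≠ ρ p ∧ (op p).target = B then
    some ((op h.choose).newValue (ρ h.choose)) else none

theorem Parked.parkedWrites_eq (h : A.Parked m K op ρ) {p : Fin n} (hp : m ≤ p.val)
    (hne : (op p).newValue (ρ p) ≠ ρ p) :
    parkedWrites m op ρ (op p).target = some ((op p).newValue (ρ p)) := by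
  have hex : ∃ q : Fin n, m ≤ q.val ∧ (op q).newValue (ρ q) ≠ ρ q ∧
      (op q).target = (op p).target := ⟨p, hp, hne, rfl⟩
  rw [parkedWrites, dif_pos hex]
  obtain ⟨h1, _, h3⟩ := hex.choose_spec
  rw [h.injective _ _ h1 hp h3]

/-- Real steps of `S` produce the overwriting, since the objects of the other parked writers already
hold what these would write. -/
theorem Parked.agree_overwrite (h : A.Parked m K op ρ) (hm : 2 ≤ m)
    (hE : A.Execution (below n m) K E) (S : Finset (Fin n))
    (hS : ∀ p ∈ S, m ≤ p.val ∧ (op p).newValue (ρ p) ≠ ρ p)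
    (hS' : ∀ p, m ≤ p.val → (op p).newValue (ρ p) ≠ ρ p → p ∉ S →
      E.value (op p).target = (op p).newValue (ρ p)) :
    ∃ D, A.Execution S E D ∧ Agree (below n 2) (overwrite E (parkedWrites m op ρ)) D ∧
      ∀ p ∈ S, D.state p = A.update p (K.state p) (E.value (op p).target) := by
  have hst : ∀ p : Fin n, m ≤ p.val → E.state p = K.state p :=
    fun p hp => hE.state_eq (not_mem_below hp)
  obtain ⟨D, hD, h1, h2, h3, h4⟩ := exists_block_execution (A := A) E op S
    (fun p hp => (h.poised p (hS p hp).1).congr (hst p (hS p hp).1))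
    (fun p hp q hq => h.injective p q (hS p hp).1 (hS q hq).1)
  refine ⟨D, hD, ⟨?_, ?_⟩, fun p hp => by rw [h1 p hp, hst p (hS p hp).1]⟩
  · funext B
    by_cases hB : ∃ p ∈ S, (op p).target = B
    · obtain ⟨p, hp, rfl⟩ := hB
      rw [h3 p hp, SwapOp.newValue_eq_of_ne (hS p hp).2]
      simp [overwrite, h.parkedWrites_eq (hS p hp).1 (hS p hp).2]
    · rw [h4 B fun p hp e => hB ⟨p, hp, e⟩]
      by_cases hB' : ∃ p : Fin n, m ≤ p.val ∧ (op p).newValue (ρ p) ≠ ρ p ∧ (op p).target = B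
      · obtain ⟨p, hp, hne, rfl⟩ := hB'
        have hpS : p ∉ S := fun hp' => hB ⟨p, hp', rfl⟩
        simp [overwrite, h.parkedWrites_eq hp hne, hS' p hp hne hpS]
      · simp [overwrite, parkedWrites, dif_neg hB']
  · intro q hq
    have hqS : q ∉ S := fun hq' => not_mem_below (hm.trans (hS q hq').1) hq
    rw [h2 q hqS]
    rfl

theorem exists_ne_mem_below_two (hn : 2 ≤ n) :
    ∀ q ∈ below n 2, ∃ q' ∈ below n 2, q' ≠ q := by
  intro q _
  by_cases hq : q.val = 0
  · exact ⟨⟨1, by omega⟩, by simp [below], fun e => by simp [← e] at hq⟩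
  · exact ⟨⟨0, by omega⟩, by simp [below], fun e => by simp [← e] at hq⟩

/-- The first two processes can reach a bivalent configuration in which no parked process finds the
value `ρ p` in its object. -/
theorem Parked.exists_forall_value_ne (h : A.Parked m K op ρ) (hn : 2 ≤ n) (hm : 2 ≤ m)
    (hof : A.ObstructionFree) {x : Fin n → Fin 2} (hx : A.ReachableFrom x K)
    (hC : A.Execution (below n m) K C) (hbiv : A.Bivalent (below n 2) C) :
    ∃ E, A.Execution (below n 2) C E ∧ A.Bivalent (below n 2) E ∧
      ∀ p : Fin n, m ≤ p.val → E.value (op p).target ≠ ρ p := by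
  classical
  obtain ⟨E, hCE, hE⟩ := hbiv.exists_overwrite (exists_ne_mem_below_two hn)
    (parkedWrites m op ρ) (by
      -- The overwritten configuration need not be reachable, but `q` cannot tell it from the one
      -- after all parked writers step.
      intro E hCE q hq
      have hKE := hC.trans (hCE.mono (below_mono hm))
      obtain ⟨D, hD, hagree, -⟩ := h.agree_overwrite hm hKE
        (Finset.univ.filter fun p => m ≤ p.val ∧ (op p).newValue (ρ p) ≠ ρ p) (by simp)
        (fun p hp hne hpS => absurd (by simp [hp, hne]) hpS)
      obtain ⟨v, hv⟩ := ((hx.execution hKE).execution hD).exists_canDecide hof q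
      refine ⟨v, Agree.canDecide (D := overwrite E _) ⟨hagree.1.symm, ?_⟩ hv⟩
      rintro r rfl
      exact (hagree.2 r hq).symm)
  have hKE := hC.trans (hCE.mono (below_mono hm))
  set S := Finset.univ.filter fun p : Fin n =>
    m ≤ p.val ∧ (op p).newValue (ρ p) ≠ ρ p ∧ E.value (op p).target = ρ p with hSdef
  have hS' : ∀ p : Fin n, m ≤ p.val → (op p).newValue (ρ p) ≠ ρ p → p ∉ S →
      E.value (op p).target = (op p).newValue (ρ p) := by
    intro p hp hne hpS
    have : E.value (op p).target ≠ ρ p := fun e => hpS (by simp [hSdef, hp, hne, e])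
    omega
  obtain ⟨D, hD, hagree, hst⟩ := h.agree_overwrite hm hKE S
    (fun p hp => by simp only [hSdef, Finset.mem_filter] at hp; exact ⟨hp.2.1, hp.2.2.1⟩) hS'
  rcases S.eq_empty_or_nonempty with hemp | hne
  · have hag : Agree (below n 2) (overwrite E (parkedWrites m op ρ)) E := by
      rw [hemp] at hD
      refine ⟨?_, fun q _ => rfl⟩
      funext B
      by_cases hB : ∃ p : Fin n, m ≤ p.val ∧ (op p).newValue (ρ p) ≠ ρ p ∧ (op p).target = B
      · obtain ⟨p, hp, hne, rfl⟩ := hB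
        simp [overwrite, h.parkedWrites_eq hp hne, hS' p hp hne (by simp [hemp])]
      · simp [overwrite, parkedWrites, dif_neg hB]
    have hEb := hag.bivalent hE
    refine ⟨E, hCE, hEb, fun p hp => ?_⟩
    by_cases htriv : (op p).newValue (ρ p) = ρ p
    · exact h.value_ne_of_trivial hm hp htriv hKE hEb
    · rw [hS' p hp htriv (by simp [hemp])]
      exact htriv
  -- The largest `p` in `S` would obtain `ρ p` with only indices at most `p` moving; hence the bound
  -- in `avoid`.
  · obtain ⟨p, hpS, hmax⟩ := S.exists_max_image (fun p => p.val) hne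
    have hp := hpS
    simp only [hSdef, Finset.mem_filter] at hp
    refine (h.false_of_agree hp.2.1 hE ((hKE.mono (below_mono (by omega))).trans
      (hD.mono fun q hq => ?_)) hagree ?_).elim
    · exact Nat.lt_succ_of_le (hmax q hq)
    · rw [hst p hpS, hp.2.2.2]

/-- While the first two processes are bivalent, no active process is poised to write `ρ p` to the
object of the parked process `p`. -/
theorem Parked.newValue_ne (h : A.Parked m K op ρ) (hn : 2 ≤ n) (hm : 2 ≤ m)
    (hof : A.ObstructionFree) {x : Fin n → Fin 2} (hx : A.ReachableFrom x K)
    (hC : A.Execution (below n m) K C) (hbiv : A.Bivalent (below n 2) C) {p : Fin n}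
    (hp : m ≤ p.val) {r : Fin n} (hr : 2 ≤ r.val) (hrm : r.val < m) {v : Fin 2}
    (hpo : A.Poised C r (.swap (op p).target v)) : v ≠ ρ p := by
  rintro rfl
  have hst : C.state p = K.state p := hC.state_eq (not_mem_below hp)
  have hrp : r ≠ p := by rintro rfl; omega
  have hr2 : r ∉ below n 2 := not_mem_below hr
  have hp2 : p ∉ below n 2 := not_mem_below (hm.trans hp)
  by_cases htriv : (op p).newValue (ρ p) = ρ p
  -- The swap of `r` realizes this overwriting, after which `p` would find `ρ p`.
  · let g : Obj → Option (Fin 2) := fun B =>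
      open Classical in if B = (op p).target then some (ρ p) else none
    have hag : ∀ E, A.Execution (below n 2) C E →
        A.Poised E r (.swap (op p).target (ρ p)) ∧
        Agree (below n 2) (overwrite E g) (A.applyOp E r (.swap (op p).target (ρ p))) := by
      intro E hE
      refine ⟨hpo.congr (hE.state_eq hr2), ?_, ?_⟩
      · funext B
        by_cases hB : B = (op p).target <;>
          simp [overwrite, g, hB, applyOp, SwapOp.target_swap, SwapOp.newValue_swap]
      · intro q hq
        have : q ≠ r := fun e => hr2 (e ▸ hq)
        simp [overwrite, applyOp, this]
    obtain ⟨E, hCE, hE⟩ := hbiv.exists_overwrite (exists_ne_mem_below_two hn) g (by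
      intro E hE q hq
      obtain ⟨h1, h2⟩ := hag E hE
      obtain ⟨v, hv⟩ := ((((hx.execution hC).execution hE).execution
        (h1.execution (Set.mem_singleton r))).exists_canDecide hof q)
      refine ⟨v, Agree.canDecide (D := overwrite E g) ⟨h2.1.symm, ?_⟩ hv⟩
      rintro s rfl
      exact (h2.2 s hq).symm)
    obtain ⟨h1, h2⟩ := hag E hCE
    refine h.value_ne_of_trivial hm hp htriv
      ((hC.trans (hCE.mono (below_mono hm))).trans (h1.execution hrm)) (h2.bivalent hE) ?_
    simp [applyOp, SwapOp.target_swap, SwapOp.newValue_swap]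
  · have hpop : A.Poised C p (op p) := (h.poised p hp).congr hst
    have hC' : A.Execution (below n (p.val + 1)) K C := hC.mono (below_mono (by omega))
    have hrmem : r ∈ below n (p.val + 1) := show r.val < p.val + 1 by omega
    have hpmem : p ∈ below n (p.val + 1) := Nat.lt_succ_self p.val
    -- Now `p` writes the value other than `ρ p`, so in a suitable order the steps of `p` and `r`
    -- restore the object and give `p` the response `ρ p`.
    by_cases hval : C.value (op p).target = ρ p
    · have hpo2 : A.Poised (A.applyOp C p (op p)) r (.swap (op p).target (ρ p)) :=
        hpo.congr (by simp [applyOp, hrp])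
      refine h.false_of_agree hp hbiv
        ((hC'.trans (hpop.execution hpmem)).trans (hpo2.execution hrmem)) ⟨?_, ?_⟩ ?_
      · funext B
        by_cases hB : B = (op p).target
        · simp [applyOp, hB, SwapOp.target_swap, SwapOp.newValue_swap, hval]
        · simp [applyOp, hB, SwapOp.target_swap]
      · intro q hq
        have h1 : q ≠ r := fun e => hr2 (e ▸ hq)
        have h2 : q ≠ p := fun e => hp2 (e ▸ hq)
        simp [applyOp, h1, h2]
      · simp [applyOp, hrp.symm, hst, hval]
    · have hpo2 : A.Poised (A.applyOp C r (.swap (op p).target (ρ p))) p (op p) :=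
        hpop.congr (by simp [applyOp, hrp.symm])
      refine h.false_of_agree hp hbiv
        ((hC'.trans (hpo.execution hrmem)).trans (hpo2.execution hpmem)) ⟨?_, ?_⟩ ?_
      · funext B
        by_cases hB : B = (op p).target
        · have : C.value (op p).target = (op p).newValue (ρ p) := by omega
          simp [applyOp, hB, SwapOp.target_swap, SwapOp.newValue_swap, this]
        · simp [applyOp, hB, SwapOp.target_swap]
      · intro q hq
        have h1 : q ≠ r := fun e => hr2 (e ▸ hq)
        have h2 : q ≠ p := fun e => hp2 (e ▸ hq)
        simp [applyOp, h1, h2]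
      · simp [applyOp, hrp.symm, hst, SwapOp.target_swap, SwapOp.newValue_swap]

/-! ### Parking one more process. -/

/-- One more process can be parked: it runs solo, assisted by the other active processes so that
the first two stay bivalent, up to the first response that it cannot be given. -/
theorem Parked.exists_succ (hn : 2 ≤ n) (hm : 2 ≤ m) (hmn : m < n)
    (h : A.Parked (m + 1) K op ρ) (hag : A.Agreement) (hof : A.ObstructionFree)
    {x : Fin n → Fin 2} (hx : A.ReachableFrom x K) :
    ∃ K' op' ρ', A.ReachableFrom x K' ∧ A.Parked m K' op' ρ' := by
  have hm' : 2 ≤ m + 1 := by omega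
  obtain ⟨E, hKE, hEb, hEv⟩ := h.exists_forall_value_ne hn hm' hof hx
    Relation.ReflTransGen.refl h.bivalent
  replace hKE : A.Execution (below n (m + 1)) K E := hKE.mono (below_mono hm')
  let r : Fin n := ⟨m, hmn⟩
  -- The states of `r` compatible with bivalence. A decided state is not among them, so the solo run
  -- leaves this set at some step.
  let Attained : State → Prop := fun s => ∃ L, A.Execution (below n (m + 1)) K L ∧
    A.Bivalent (below n 2) L ∧ L.state r = s
  obtain ⟨F, hEF, v, hFv⟩ := hof x E (hx.execution hKE) r
  have hF : ¬ Attained (F.state r) := by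
    rintro ⟨L, hL, hLb, hst⟩
    refine hLb.not_hasDecided hag (hx.execution hL) r v ?_
    unfold HasDecided at *
    rw [hst, hFv]
  obtain ⟨G, o, hGpo, hGv, hGA, hGA'⟩ : ∃ G o, A.Poised G r o ∧
      (∀ p : Fin n, m + 1 ≤ p.val → G.value (op p).target ≠ ρ p) ∧ Attained (G.state r) ∧
      ¬ Attained (A.update r (G.state r) (G.value o.target)) := by
    by_contra hno
    have key : (∀ p : Fin n, m + 1 ≤ p.val → F.value (op p).target ≠ ρ p) ∧
        Attained (F.state r) := by
      clear hFv hF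
      induction hEF with
      | refl => exact ⟨hEv, E, hKE, hEb, rfl⟩
      | @tail G G' _ hs ih =>
        obtain ⟨hGv, hGA⟩ := ih
        obtain ⟨_, rfl, o, hpo, rfl⟩ := hs
        have hA : Attained (A.update r (G.state r) (G.value o.target)) :=
          by_contra fun hA => hno ⟨G, o, hpo, hGv, hGA, hA⟩
        refine ⟨fun p hp => ?_, ?_⟩
        · by_cases ht : (op p).target = o.target
          · cases o with
            | read B =>
              simp only [applyOp, SwapOp.newValue, Function.update_eq_self]
              exact hGv p hp
            | swap B w =>
              obtain rfl : (op p).target = B := ht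
              -- `G` need not be bivalent, but `L` is, and `r` is poised at the same operation
              -- there.
              obtain ⟨L, hL, hLb, hst⟩ := hGA
              have := h.newValue_ne hn hm' hof hx hL hLb hp (r := r) hm (Nat.lt_succ_self m)
                (hpo.congr hst)
              simpa [applyOp, SwapOp.target_swap, SwapOp.newValue_swap] using this
          · simp only [applyOp, ne_eq, ht, not_false_eq_true, Function.update_of_ne]
            exact hGv p hp
        · simpa [applyOp] using hA
    exact hF key.2
  obtain ⟨L, hL, hLb, hst⟩ := hGA
  have hLpo : A.Poised L r o := hGpo.congr hst
  -- At an occupied object, `G` and a bivalent `M` both hold the value other than `ρ p`; the step of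
  -- `r` in `M` changes no object, so its next state would be attained.
  have hnew : ∀ p : Fin n, m + 1 ≤ p.val → (op p).target ≠ o.target := by
    intro p hp ht
    obtain ⟨M, hLM, hMb, hMv⟩ := h.exists_forall_value_ne hn hm' hof hx hL hLb
    have hKM := hL.trans (hLM.mono (below_mono hm'))
    have hMst : M.state r = L.state r := hLM.state_eq (not_mem_below hm)
    have hval : M.value o.target = G.value o.target := by
      have h1 := hMv p hp
      have h2 := hGv p hp
      rw [ht] at h1 h2
      omega
    have htriv : o.newValue (M.value o.target) = M.value o.target := by
      cases o with
      | read B => rfl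
      | swap B w =>
        obtain rfl : (op p).target = B := ht
        have h1 := h.newValue_ne hn hm' hof hx hL hLb hp (r := r) hm (Nat.lt_succ_self m) hLpo
        have h2 := hMv p hp
        simp only [SwapOp.newValue_swap, SwapOp.target_swap]
        omega
    refine hGA' ⟨A.applyOp M r o,
      hKM.trans ((hLpo.congr hMst).execution (Nat.lt_succ_self m)),
      (agree_applyOp (not_mem_below hm) htriv).bivalent hMb, ?_⟩
    simp [applyOp, hMst, hst, hval]
  have hr : ∀ p : Fin n, m ≤ p.val → p ≠ r → m + 1 ≤ p.val := by
    intro p hp hpr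
    have : p.val ≠ m := fun e => hpr (Fin.ext e)
    omega
  -- Parking happens at the bivalent `L`; the solo run supplies only the forbidden response.
  refine ⟨L, Function.update op r o, Function.update ρ r (G.value o.target), hx.execution hL,
    hLb, ?_, ?_, ?_⟩
  · intro p hp
    by_cases hpr : p = r
    · subst hpr
      simpa using hLpo
    · rw [Function.update_of_ne hpr]
      exact (h.poised p (hr p hp hpr)).congr (hL.state_eq (not_mem_below (hr p hp hpr)))
  · intro p hp M hLM hMb
    by_cases hpr : p = r
    · subst hpr
      rw [Function.update_self, hst]
      exact fun e => hGA' ⟨M, hL.trans hLM, hMb, e⟩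
    · have hp' := hr p hp hpr
      rw [Function.update_of_ne hpr, hL.state_eq (not_mem_below hp')]
      exact h.avoid p hp' M ((hL.mono (below_mono (by omega))).trans hLM) hMb
  · intro p q hp hq ht
    by_cases hpr : p = r <;> by_cases hqr : q = r
    · rw [hpr, hqr]
    · rw [hpr, Function.update_self, Function.update_of_ne hqr] at ht
      exact absurd ht.symm (hnew q (hr q hq hqr))
    · rw [hqr, Function.update_self, Function.update_of_ne hpr] at ht
      exact absurd ht (hnew p (hr p hp hpr))
    · rw [Function.update_of_ne hpr, Function.update_of_ne hqr] at ht
      exact h.injective p q (hr p hp hpr) (hr q hq hqr) ht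

/-! ### The initial configuration and the induction. -/

/-- Running alone, `p` cannot rule out that all inputs equal `x p`, where validity forces the
decision. -/
theorem canDecide_initConfig (hval : A.Validity) (hof : A.ObstructionFree) (x : Fin n → Fin 2)
    (p : Fin n) : A.CanDecide {p} (A.initConfig x) (x p) := by
  have hagree : Agree {p} (A.initConfig fun _ => x p) (A.initConfig x) := by
    refine ⟨rfl, ?_⟩
    rintro q rfl
    rfl
  obtain ⟨C', hC', v, hv⟩ := hof (fun _ => x p) _ Relation.ReflTransGen.refl p
  obtain ⟨q, hq⟩ := hval (fun _ => x p) C' (hC'.mono (Set.subset_univ _)) p v hv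
  have : v = x p := hq.symm
  subst this
  exact hagree.canDecide ⟨C', hC', p, rfl, hv⟩

theorem exists_bivalent_initConfig (hn : 2 ≤ n) (hval : A.Validity) (hof : A.ObstructionFree) :
    ∃ x, A.Bivalent (below n 2) (A.initConfig x) := by
  refine ⟨fun p => if p.val = 0 then 0 else 1, fun v => ?_⟩
  have h0 := canDecide_initConfig hval hof (fun p => if p.val = 0 then 0 else 1) ⟨0, by omega⟩
  have h1 := canDecide_initConfig hval hof (fun p => if p.val = 0 then 0 else 1) ⟨1, by omega⟩
  have hv : v = 0 ∨ v = 1 := by omega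
  rcases hv with rfl | rfl
  · exact h0.mono (by simp [below])
  · exact h1.mono (by simp [below])

theorem exists_parked (hn : 2 ≤ n) (hcons : A.IsBinaryConsensus) (hof : A.ObstructionFree)
    (hm : 2 ≤ m) (hmn : m ≤ n) : ∃ x K op ρ, A.ReachableFrom x K ∧ A.Parked m K op ρ := by
  induction hmn using Nat.decreasingInduction with
  | self =>
    obtain ⟨x, hx⟩ := exists_bivalent_initConfig hn hcons.2 hof
    rcases hs : A.status ⟨0, by omega⟩ ((A.initConfig x).state ⟨0, by omega⟩) with v | o
    · exact absurd hs (hx.not_hasDecided hcons.1 (x := x) Relation.ReflTransGen.refl _ v)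
    · exact ⟨x, _, fun _ => o, fun _ => 0, Relation.ReflTransGen.refl, hx,
        fun p hp => absurd p.isLt (by omega), fun p hp => absurd p.isLt (by omega),
        fun p _ hp => absurd p.isLt (by omega)⟩
  | of_succ k hk ih =>
    obtain ⟨x, K, op, ρ, hx, h⟩ := ih (by omega)
    obtain ⟨K', op', ρ', hx', h'⟩ := h.exists_succ hn hm hk hcons.1 hof hx
    exact ⟨x, K', op', ρ', hx', h'⟩

end SwapAlgorithm

theorem mainTheorem3 {n : ℕ} (hn : 2 ≤ n) {Obj State : Type*} (A : SwapAlgorithm n Obj State)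
    (hcons : A.IsBinaryConsensus) (hof : A.ObstructionFree) :
    ((n - 2 : ℕ) : ℕ∞) ≤ ENat.card Obj := by
  obtain ⟨x, K, op, ρ, -, h⟩ := A.exists_parked hn hcons hof le_rfl hn
  let f : Fin (n - 2) → Obj := fun i => (op ⟨i.val + 2, by omega⟩).target
  have hf : Function.Injective f := by
    intro i j hij
    have := h.injective _ _ (Nat.le_add_left 2 i.val) (Nat.le_add_left 2 j.val) hij
    simpa [Fin.ext_iff] using this
  simpa using ENat.card_le_card_of_injective hf
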